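/- Let $\Sigma$ be a compact connected oriented surface without boundary, and let $\Lambda$ be a bipartite quad-decomposition of $\Sigma$: a cellular decomposition into embedded quadrilaterals whose vertices are coloured black and white such that neighbours have different colours, and which is strongly regular (two different faces are disjoint, or share only one vertex, or share only one edge). Let $z$ be an atlas, i.e. for each face $Q$, with vertices $b_-,w_-,b_+,w_+$ in counterclockwise order ($b_\pm$ black, $w_\pm$ white), a chart $z_Q$ that maps these vertices to the vertices of a positively oriented rectilinear quadrilateral in $\mathbb C$ without self-intersections. So $(\Sigma,\Lambda,z)$ is a compact discrete Riemann surface. The medial graph $X$ has as vertices the midpoints of the edges of $\Lambda$, and for each face $Q$ and each vertex $v$ of $Q$ an edge $[Q,v]$ that joins the midpoints of the two edges of $Q$ at $v$. It is a cellular decomposition of $\Sigma$ with faces $F_v$ ($v$ a vertex of $\Lambda$) and $F_Q$ ($Q$ a face of $\Lambda$). The edge $[Q,v]$ is called black if $v$ is white (it is then parallel to the black diagonal of $Q$), and white if $v$ is black. A discrete differential $\omega$ is a complex function on the oriented edges of $X$ with $\omega(-e)=-\omega(e)$; it is of type $\Diamond$ if $\omega([Q,v])=-\omega([Q,v'])$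 whenever $v,v'$ are opposite vertices of a face $Q$, both edges being oriented by $\partial F_Q$. It is closed, $d\omega=0$, if $\oint_{\partial F}\omega=0$ for all faces $F$ of $X$. On each $F_Q$ a differential of type $\Diamond$ is $\omega=p\,dz_Q+q\,d\bar z_Q$ with unique $p,q\in\mathbb C$, where $dz_Q$ takes on an oriented edge of $X$ half the difference of the values of $z_Q$ at the end points of the parallel diagonal; put $\star\omega=-ip\,dz_Q+iq\,d\bar z_Q$ on $\partial F_Q$. A discrete differential is discrete harmonic if it is of type $\Diamond$, $d\omega=0$ and $d\star\omega=0$. For a closed path $P$ on $X$ the black (white) period of $\omega$ along $P$ is $2\int_{BP}\omega$ ($2\int_{WP}\omega$), where $BP$ ($WP$) is the $1$-chain of the black (white) edges of $P$. Let $g$ be the genus of $\Sigma$ and let $\alpha_1,\dots,\alpha_g,\beta_1,\dots,\beta_g$ be closed paths on $X$ whose homology classes form a basis of $H_1(\Sigma,\mathbb Z)$, for instance a canonical homology basis $a_1,\dots,a_g,b_1,\dots,b_g$. **Theorem.** Let $A_k^B,B_k^B,A_k^W,B_k^W$, $1\le k\le g$, be $4g$ given complex numbers. Then there exists a unique discrete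 harmonic differential $\omega$ whose black and white periods are these numbers: for $1\le k\le g$ it has black period $A_k^B$ and white period $A_k^W$ along $\alpha_k$, and black period $B_k^B$ and white period $B_k^W$ along $\beta_k$. -/

import Mathlib

open scoped ComplexConjugate

noncomputable section

/-- The corners of a family `F` of oriented quadrilaterals: `(Q, i)` is the `i`-th corner of `Q`,
the corners being numbered in counterclockwise order. The pair `(Q, i)` also labels the side of `Q`
that goes from corner `i` to corner `i + 1` along the oriented boundary of `Q`. -/
abbrev QuadCorner (F : Type*) := F × Fin 4

namespace QuadCorner

variable {F : Type*}

/-- The next corner of the same quadrilateral, counterclockwise. -/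
def next (c : QuadCorner F) : QuadCorner F := (c.1, c.2 + 1)

/-- The cyclic permutation that takes every corner to the preceding corner of its
quadrilateral. -/
def prev : Equiv.Perm (QuadCorner F) := (Equiv.refl F).prodCongr (Equiv.subRight (1 : Fin 4))

/-- The corners of a quadrilateral are `b₋, w₋, b₊, w₊` in this order: corners `0` and `2` are
black, corners `1` and `3` are white. -/
def IsBlack (c : QuadCorner F) : Prop := c.2 = 0 ∨ c.2 = 2

instance (c : QuadCorner F) : Decidable c.IsBlack := inferInstanceAs (Decidable (_ ∨ _))

end QuadCorner

/-- A cellular decomposition of an oriented surface without boundary into quadrilaterals, with a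
bipartition of its vertices, given by its gluing data: the surface is obtained from the disjoint
oriented quadrilaterals `Q : F` by identifying each side `c` with the side `opp c`, reversing
orientation. (Gluing finitely many oriented polygons along an orientation reversing pairing of their
sides gives a closed oriented surface with a cell decomposition, and every cell decomposition
of a closed oriented surface into quadrilaterals arises in this way.) -/
structure QuadGluing (F : Type*) where
  /-- the side that a side is glued to -/
  opp : Equiv.Perm (QuadCorner F)
  opp_opp : ∀ c, opp (opp c) = c
  opp_ne : ∀ c, opp c ≠ c
  /-- The starting point of `opp c` is the end point of `c`, and has the other colour than the
  starting point of `c`. -/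
  opp_isBlack : ∀ c, (opp c).IsBlack ↔ ¬ c.IsBlack

namespace QuadGluing

variable {F : Type*} (L : QuadGluing F)

/-- The rotation about a vertex: it takes a corner to the next corner at the same vertex in
counterclockwise order, across the side that ends in the given corner. -/
def rot : Equiv.Perm (QuadCorner F) := QuadCorner.prev.trans L.opp

/-- The vertices (0-cells) of the decomposition: corners that are identified by the gluing. -/
def Vertex : Type _ := Quotient (Equiv.Perm.SameCycle.setoid L.rot)

/-- The edges (1-cells) of the decomposition: sides that are identified by the gluing. -/
def Edge : Type _ := Quotient (Equiv.Perm.SameCycle.setoid L.opp)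

/-- The vertex at which a corner lies. -/
def vertex (c : QuadCorner F) : L.Vertex := Quotient.mk _ c

/-- The edge on which a side lies. -/
def edge (c : QuadCorner F) : L.Edge := Quotient.mk _ c

end QuadGluing

/-- A bipartite quad-decomposition of a connected oriented surface without boundary, with face set
`F`. The surface is compact if and only if `F` is finite. -/
structure BipartiteQuadDecomposition (F : Type*) extends QuadGluing F where
  /-- the surface is connected -/
  connected : ∀ Q Q' : F, Relation.ReflTransGen (fun P P' => ∃ i j, opp (P, i) = (P', j)) Q Q'
  /-- closed faces are embedded: the four corners of a face are four different vertices -/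
  regular : ∀ Q i j, toQuadGluing.vertex (Q, i) = toQuadGluing.vertex (Q, j) → i = j
  /-- strong regularity: two different faces are disjoint, or share only one vertex (first case), or
  share only one edge with its two end points (second case) -/
  strongly_regular : ∀ Q Q', Q ≠ Q' →
    (∀ i j i' j', toQuadGluing.vertex (Q, i) = toQuadGluing.vertex (Q', j) →
      toQuadGluing.vertex (Q, i') = toQuadGluing.vertex (Q', j') → i = i') ∨
    (∃ k l, opp (Q, k) = (Q', l) ∧
      ∀ i j, toQuadGluing.vertex (Q, i) = toQuadGluing.vertex (Q', j) → i = k ∨ i = k + 1)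

/-- The images `z 0, z 1, z 2, z 3` of the corners of a quadrilateral under a chart: they are the
vertices of a rectilinear quadrilateral in `ℂ` without self-intersections (opposite
sides are disjoint, consecutive sides meet in their common vertex only) that is positively oriented
(its area, computed with sign by the shoelace formula, is positive). -/
structure IsQuadChart (z : Fin 4 → ℂ) : Prop where
  opposite : ∀ i, Disjoint (segment ℝ (z i) (z (i + 1))) (segment ℝ (z (i + 2)) (z (i + 3)))
  consecutive : ∀ i, segment ℝ (z i) (z (i + 1)) ∩ segment ℝ (z (i + 1)) (z (i + 2)) = {z (i + 1)}
  area_pos : 0 < (1 / 2 : ℝ) * ∑ i, (conj (z i) * z (i + 1)).im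

/-- A discrete Riemann surface: a bipartite quad-decomposition of a surface, with an atlas, that is,
a chart for each face. Here `z Q i` is the image of the `i`-th corner of `Q` under the chart of
`Q`. -/
structure DiscreteRiemannSurface (F : Type*) extends BipartiteQuadDecomposition F where
  z : F → Fin 4 → ℂ
  isQuadChart : ∀ Q, IsQuadChart (z Q)

namespace DiscreteRiemannSurface

variable {F : Type*} (S : DiscreteRiemannSurface F)

/-! ### The medial graph

Its vertices are (the midpoints of) the edges of the decomposition. Its edges `[Q, v]` are labelled
by the corners `c = (Q, i)`: this edge joins the midpoints of the two sides of `Q` that meet in the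
corner `c`. Its faces are the `F_v` and the `F_Q`. -/

/-- The faces of the medial graph: `F_v` for the vertices `v`, and `F_Q` for the faces `Q`. -/
abbrev MedialFace := S.Vertex ⊕ F

/-- The oriented edges of the medial graph. `(c, true)` is the edge at the corner
`c = (Q, i)` with the orientation of the counterclockwise boundary of `F_Q`: it goes from the
midpoint of the side `(Q, i - 1)` to the midpoint of the side `(Q, i)`. `(c, false)` is the same edge
with the opposite orientation. -/
abbrev MedialEdge (_S : DiscreteRiemannSurface F) := QuadCorner F × Bool

/-- The initial vertex of an oriented edge of the medial graph. -/
def source : S.MedialEdge → S.Edge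
  | (c, true) => S.edge (QuadCorner.prev c)
  | (c, false) => S.edge c

/-- The final vertex of an oriented edge of the medial graph. -/
def target : S.MedialEdge → S.Edge
  | (c, true) => S.edge c
  | (c, false) => S.edge (QuadCorner.prev c)

/-- The edge with the opposite orientation. -/
def reverse (e : S.MedialEdge) : S.MedialEdge := (e.1, !e.2)

/-! ### The cellular chain complex of the medial graph and the first homology group -/

/-- Integral 1-chains on the medial graph; the generator at the corner `c` is the oriented edge
`(c, true)`. -/
abbrev Chain (_S : DiscreteRiemannSurface F) := QuadCorner F →₀ ℤ

/-- The 1-chain of an oriented edge. -/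
def edgeChain : S.MedialEdge → S.Chain
  | (c, true) => Finsupp.single c 1
  | (c, false) => -Finsupp.single c 1

/-- The counterclockwise boundary of a face of the medial graph. It runs through the edges of `F_Q`
in their standard orientation; the face `F_v` lies on the other side of the edges at the corners
of `v`, so these are run through in the opposite orientation. -/
def faceBoundary [Fintype F] : S.MedialFace → S.Chain := by
  classical
  exact Sum.elim
    (fun v => ∑ c : QuadCorner F with S.vertex c = v, S.edgeChain (c, false))
    (fun Q => ∑ i : Fin 4, S.edgeChain ((Q, i), true))

/-- The boundary map from 1-chains to 0-chains. -/
def boundary₁ : S.Chain →ₗ[ℤ] (S.Edge →₀ ℤ) :=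
  Finsupp.linearCombination ℤ fun c =>
    Finsupp.single (S.target (c, true)) (1 : ℤ) - Finsupp.single (S.source (c, true)) 1

/-- The boundary map from 2-chains to 1-chains. -/
def boundary₂ [Fintype F] : (S.MedialFace →₀ ℤ) →ₗ[ℤ] S.Chain :=
  Finsupp.linearCombination ℤ S.faceBoundary

/-- The first homology group with integral coefficients of the surface, as the cellular homology
of the decomposition given by the medial graph. -/
abbrev H₁ [Fintype F] :=
  LinearMap.ker S.boundary₁ ⧸ (LinearMap.range S.boundary₂).submoduleOf (LinearMap.ker S.boundary₁)

/-- `S.IsPath x l y`: the list `l` of oriented edges is a directed path from `x` to `y` on the medial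
graph. -/
def IsPath : S.Edge → List S.MedialEdge → S.Edge → Prop
  | x, [], y => x = y
  | x, e :: l, y => S.source e = x ∧ IsPath (S.target e) l y

/-- A closed directed path on the medial graph. -/
structure ClosedPath where
  base : S.Edge
  edges : List S.MedialEdge
  isPath : S.IsPath base edges base

variable {S} in
/-- The 1-chain of a closed path. -/
def ClosedPath.chain (P : S.ClosedPath) : S.Chain := (P.edges.map S.edgeChain).sum

theorem boundary₁_edgeChain (e : S.MedialEdge) : S.boundary₁ (S.edgeChain e) =
    Finsupp.single (S.target e) (1 : ℤ) - Finsupp.single (S.source e) 1 := by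
  rcases e with ⟨c, _ | _⟩ <;> simp [edgeChain, boundary₁, source, target]

theorem boundary₁_of_isPath (l : List S.MedialEdge) (x y : S.Edge) (h : S.IsPath x l y) :
    S.boundary₁ (l.map S.edgeChain).sum =
      Finsupp.single y (1 : ℤ) - Finsupp.single x 1 := by
  induction l generalizing x with
  | nil => obtain rfl : x = y := h
           simp
  | cons e l ih =>
    obtain ⟨rfl, h₂⟩ := h
    rw [List.map_cons, List.sum_cons, map_add, ih _ h₂, boundary₁_edgeChain]
    abel

variable {S} in
theorem ClosedPath.chain_mem_ker (P : S.ClosedPath) : P.chain ∈ LinearMap.ker S.boundary₁ := by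
  rw [LinearMap.mem_ker, ClosedPath.chain, S.boundary₁_of_isPath _ _ _ P.isPath, sub_self]

variable {S} in
/-- The homology class of a closed path. -/
def ClosedPath.homologyClass [Fintype F] (P : S.ClosedPath) : S.H₁ :=
  Submodule.Quotient.mk ⟨P.chain, P.chain_mem_ker⟩

/-- The homology classes of the closed paths `α k` and `β k`, `k = 1, …, g`, together form a basis of
the free abelian group `H₁`. In particular its rank is `2 * g`, so `g` is the genus of the surface. -/
def IsHomologyBasis [Fintype F] {g : ℕ} (α β : Fin g → S.ClosedPath) : Prop :=
  LinearIndependent ℤ (Sum.elim (fun k => (α k).homologyClass) fun k => (β k).homologyClass) ∧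
  Submodule.span ℤ
    (Set.range (Sum.elim (fun k => (α k).homologyClass) fun k => (β k).homologyClass)) = ⊤

/-! ### Discrete differentials -/

/-- A discrete one-form (discrete differential): a complex function on the oriented edges of
the medial graph that changes sign with the orientation. -/
@[ext] structure OneForm where
  toFun : S.MedialEdge → ℂ
  reverse : ∀ e, toFun (S.reverse e) = -toFun e

/-- The values of `dz_Q` on the oriented edges of `F_Q`: half of the parallel diagonal. -/
def dz : S.MedialEdge → ℂ
  | ((Q, i), true) => (S.z Q (i + 1) - S.z Q (i - 1)) / 2
  | ((Q, i), false) => -((S.z Q (i + 1) - S.z Q (i - 1)) / 2)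

namespace OneForm

variable {S} (ω : S.OneForm)

/-- The integral of a discrete one-form along a 1-chain. -/
def integral (γ : S.Chain) : ℂ := γ.sum fun c n => (n : ℂ) * ω.toFun (c, true)

/-- The discrete exterior derivative, a function on the faces of the medial graph. -/
def d [Fintype F] (φ : S.MedialFace) : ℂ := ω.integral (S.faceBoundary φ)

/-- A one-form is of type `◇` if, on each face `F_Q`, it takes opposite values on opposite edges,
oriented by the boundary of `F_Q`. -/
def IsTypeDiamond : Prop := ∀ Q i, ω.toFun ((Q, i + 2), true) = -ω.toFun ((Q, i), true)

/-- The coefficient `p` in `ω = p dz_Q + q dz̄_Q` on `F_Q`, for `ω` of type `◇`. -/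
def coeffDz (Q : F) : ℂ :=
  (ω.toFun ((Q, 1), true) * conj (S.dz ((Q, 2), true)) -
      ω.toFun ((Q, 2), true) * conj (S.dz ((Q, 1), true))) /
    (S.dz ((Q, 1), true) * conj (S.dz ((Q, 2), true)) -
      S.dz ((Q, 2), true) * conj (S.dz ((Q, 1), true)))

/-- The coefficient `q` in `ω = p dz_Q + q dz̄_Q` on `F_Q`, for `ω` of type `◇`. -/
def coeffDzBar (Q : F) : ℂ :=
  (S.dz ((Q, 1), true) * ω.toFun ((Q, 2), true) -
      S.dz ((Q, 2), true) * ω.toFun ((Q, 1), true)) /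
    (S.dz ((Q, 1), true) * conj (S.dz ((Q, 2), true)) -
      S.dz ((Q, 2), true) * conj (S.dz ((Q, 1), true)))

/-- The discrete Hodge star on one-forms of type `◇`: on `F_Q` it takes `p dz_Q + q dz̄_Q` to
`-i p dz_Q + i q dz̄_Q`. -/
def hodgeStar : S.OneForm where
  toFun e := -Complex.I * ω.coeffDz e.1.1 * S.dz e + Complex.I * ω.coeffDzBar e.1.1 * conj (S.dz e)
  reverse := by
    rintro ⟨⟨Q, i⟩, _ | _⟩ <;> simp [DiscreteRiemannSurface.reverse, dz] <;> ring

/-- A discrete differential is discrete harmonic if it is of type `◇`, closed and co-closed. -/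
structure IsHarmonic [Fintype F] : Prop where
  isTypeDiamond : ω.IsTypeDiamond
  closed : ∀ φ, ω.d φ = 0
  coclosed : ∀ φ, ω.hodgeStar.d φ = 0

/-- The black period along a closed path `P`: twice the integral along the 1-chain that consists of
the black edges of `P`. An edge `[Q, v]` is black if it is parallel to the black diagonal of `Q`,
that is, if `v` is white. -/
def blackPeriod (P : S.ClosedPath) : ℂ :=
  2 * ω.integral (P.chain.filter fun c => ¬ c.IsBlack)

/-- The white period along a closed path `P`: twice the integral along the 1-chain that consists of
the white edges `[Q, v]` of `P`, those for which `v` is black. -/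
def whitePeriod (P : S.ClosedPath) : ℂ :=
  2 * ω.integral (P.chain.filter fun c => c.IsBlack)

theorem dz_det_ne_zero (S : DiscreteRiemannSurface F) (Q : F) :
    S.dz ((Q, 1), true) * conj (S.dz ((Q, 2), true)) -
      S.dz ((Q, 2), true) * conj (S.dz ((Q, 1), true)) ≠ 0 := by
  have h := (S.isQuadChart Q).area_pos
  intro h0
  have h1 := congrArg Complex.im h0
  simp [dz, Fin.sum_univ_four, show conj (2 : ℂ) = 2 from map_ofNat _ 2] at h h1
  linarith

/-- The coefficients `p` and `q` are the unique ones with `ω = p dz_Q + q dz̄_Q` on `F_Q`. -/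
theorem eq_dz_add_dzBar_iff (hω : ω.IsTypeDiamond) (Q : F) (p q : ℂ) :
    (∀ i s, ω.toFun ((Q, i), s) = p * S.dz ((Q, i), s) + q * conj (S.dz ((Q, i), s))) ↔
      p = ω.coeffDz Q ∧ q = ω.coeffDzBar Q := by
  have hd := dz_det_ne_zero S Q
  constructor
  · intro h
    rw [coeffDz, coeffDzBar, eq_div_iff hd, eq_div_iff hd, h 1 true, h 2 true]
    constructor <;> ring
  · rintro ⟨rfl, rfl⟩
    have h1 : ω.toFun ((Q, 1), true) = ω.coeffDz Q * S.dz ((Q, 1), true) +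
        ω.coeffDzBar Q * conj (S.dz ((Q, 1), true)) := by
      rw [coeffDz, coeffDzBar, div_mul_eq_mul_div, div_mul_eq_mul_div, ← add_div, eq_div_iff hd]
      ring
    have h2 : ω.toFun ((Q, 2), true) = ω.coeffDz Q * S.dz ((Q, 2), true) +
        ω.coeffDzBar Q * conj (S.dz ((Q, 2), true)) := by
      rw [coeffDz, coeffDzBar, div_mul_eq_mul_div, div_mul_eq_mul_div, ← add_div, eq_div_iff hd]
      ring
    have ht : ∀ i, ω.toFun ((Q, i), true) = ω.coeffDz Q * S.dz ((Q, i), true) +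
        ω.coeffDzBar Q * conj (S.dz ((Q, i), true)) := by
      have e3 : S.dz ((Q, 3), true) = -S.dz ((Q, 1), true) := by
        change (S.z Q 0 - S.z Q 2) / 2 = -((S.z Q 2 - S.z Q 0) / 2)
        ring
      have e0 : S.dz ((Q, 0), true) = -S.dz ((Q, 2), true) := by
        change (S.z Q 1 - S.z Q 3) / 2 = -((S.z Q 3 - S.z Q 1) / 2)
        ring
      have w3 : ω.toFun ((Q, 3), true) = -ω.toFun ((Q, 1), true) := hω Q 1
      have w0 : ω.toFun ((Q, 0), true) = -ω.toFun ((Q, 2), true) := hω Q 2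
      intro i
      fin_cases i
      · change ω.toFun ((Q, 0), true) = ω.coeffDz Q * S.dz ((Q, 0), true) +
          ω.coeffDzBar Q * conj (S.dz ((Q, 0), true))
        rw [w0, h2, e0, map_neg]
        ring
      · exact h1
      · exact h2
      · change ω.toFun ((Q, 3), true) = ω.coeffDz Q * S.dz ((Q, 3), true) +
          ω.coeffDzBar Q * conj (S.dz ((Q, 3), true))
        rw [w3, h1, e3, map_neg]
        ring
    intro i s
    cases s
    · have hr : ω.toFun ((Q, i), false) = -ω.toFun ((Q, i), true) := ω.reverse ((Q, i), true)
      have hz : S.dz ((Q, i), false) = -S.dz ((Q, i), true) := rfl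
      rw [hr, hz, ht i, map_neg]
      ring
    · exact ht i

end OneForm

end DiscreteRiemannSurface

end

/-! The proof is a discrete Hodge decomposition, run separately for the two colours. A medial edge
at a corner is parallel to the diagonal joining the two neighbouring corners. All edges of `F_v` lie
at `v` and so have one colour, and on `F_Q` a form of type ◇ is automatically closed. Hence the
black and white parts of a closed form of type ◇ are closed of type ◇, and its periods record two
independent cohomology classes.

Existence of some closed form: a cocycle can be changed by a coboundary so that it vanishes on all
edges of one colour, and closedness on `F_Q` then forces type ◇ (`exists_closed_diamond`). Doing
this once per colour realizes all periods (`exists_periods`). Subtracting a gradient changes no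
period (`halfPeriod_grad`), and the gradient can be chosen so that the rest is orthogonal to all
gradients for the Dirichlet form (`exists_grad_orthogonal`). By Stokes, this orthogonality is
co-closedness (`dirichlet_grad_eq_zero_iff`).

Uniqueness: a difference of two solutions has no periods, so it is a gradient (`mem_range_grad`). It
is also orthogonal to all gradients, and vanishes by definiteness (`eq_zero_of_mem_range_grad`). -/

/-! ### Extension of homomorphisms and coboundaries of a permutation -/

/-- A homomorphism from a subgroup to a vector space over `ℚ` extends to the whole group. -/
theorem exists_intLinear_extension {M : Type*} [AddCommGroup M] (N : Submodule ℤ M)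
    (φ : N →ₗ[ℤ] ℂ) : ∃ ψ : M →ₗ[ℤ] ℂ, ∀ x : N, ψ x = φ x := by
  obtain ⟨ψ, hψ⟩ := (Module.Baer.of_divisible ℂ).extension_property N.subtype
    N.injective_subtype φ
  exact ⟨ψ, fun x => LinearMap.congr_fun hψ x⟩

/-- A homomorphism to `ℂ` that vanishes on the kernel of `f` factors through `f`. -/
theorem exists_intLinear_factor {M N : Type*} [AddCommGroup M] [AddCommGroup N]
    (f : M →ₗ[ℤ] N) (φ : M →ₗ[ℤ] ℂ) (h : ∀ x ∈ LinearMap.ker f, φ x = 0) :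
    ∃ ψ : N →ₗ[ℤ] ℂ, ∀ x, ψ (f x) = φ x := by
  obtain ⟨ψ, hψ⟩ := exists_intLinear_extension (LinearMap.range f)
    ((LinearMap.ker f).liftQ φ (fun x hx => h x hx) ∘ₗ f.quotKerEquivRange.symm.toLinearMap)
  refine ⟨ψ, fun x => ?_⟩
  have := hψ ⟨f x, x, rfl⟩
  rw [this]
  have h2 : f.quotKerEquivRange.symm ⟨f x, x, rfl⟩ = (LinearMap.ker f).mkQ x := by
    rw [LinearEquiv.symm_apply_eq]; rfl
  simp only [LinearMap.comp_apply, LinearEquiv.coe_coe]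
  rw [h2]
  rfl

/-- A function on a finite set whose sums over the cycles of a permutation vanish is a
coboundary. -/
theorem Equiv.Perm.exists_sub_comp_eq {X : Type*} [Fintype X] (σ : Equiv.Perm X) (a : X → ℂ)
    (h : ∀ f : X → ℂ, (∀ x, f (σ x) = f x) → ∑ x, f x * a x = 0) :
    ∃ k : X → ℂ, ∀ x, k x - k (σ x) = a x := by
  classical
  let T : (X → ℂ) →ₗ[ℂ] (X → ℂ) := LinearMap.id - LinearMap.funLeft ℂ ℂ σ
  suffices a ∈ LinearMap.range T by
    obtain ⟨k, rfl⟩ := this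
    exact ⟨k, fun x => rfl⟩
  -- Duality: a functional that kills the range of `T` has σ-invariant coefficients `φ (Pi.single x
  -- 1)`, so the hypothesis makes it kill `a`.
  by_contra ha
  obtain ⟨φ, hφ, hφT⟩ := Submodule.exists_dual_map_eq_bot_of_notMem ha inferInstance
  have key : ∀ b : X → ℂ, φ b = ∑ x, φ (Pi.single x 1) * b x := by
    intro b
    conv_lhs => rw [← Finset.univ_sum_single b, map_sum]
    refine Finset.sum_congr rfl fun x _ => ?_
    rw [show Pi.single x (b x) = b x • (Pi.single x (1 : ℂ) : X → ℂ) by simp [← Pi.single_smul],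
      map_smul, smul_eq_mul, mul_comm]
  apply hφ
  rw [key]
  refine h _ fun x => ?_
  have hT : φ (T (Pi.single (σ x) 1)) = 0 := by
    have : φ (T (Pi.single (σ x) 1)) ∈ (LinearMap.range T).map φ := ⟨_, ⟨_, rfl⟩, rfl⟩
    rwa [hφT] at this
  have hs : T (Pi.single (σ x) 1) = Pi.single (σ x) 1 - Pi.single x 1 := by
    ext y
    simp [T, LinearMap.funLeft, Pi.single_apply]
  rw [hs, map_sub, sub_eq_zero] at hT
  exact hT

/-! ### Corners, rotations and colour classes -/

namespace QuadCorner

variable {F : Type*}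

@[simp] theorem prev_next (c : QuadCorner F) : prev (next c) = c := by
  simp [prev, next]

@[simp] theorem next_prev (c : QuadCorner F) : next (prev c) = c := by
  simp [prev, next]

end QuadCorner

namespace QuadGluing

variable {F : Type*} (L : QuadGluing F)

open QuadCorner

theorem rot_apply (c : QuadCorner F) : L.rot c = L.opp (prev c) := rfl

@[simp] theorem rot_next_opp (c : QuadCorner F) : L.rot (next (L.opp c)) = c := by
  simp [rot_apply, L.opp_opp]

@[simp] theorem vertex_rot (c : QuadCorner F) : L.vertex (L.rot c) = L.vertex c :=
  Quotient.sound (Equiv.Perm.sameCycle_apply_left.2 (Equiv.Perm.SameCycle.refl _ _))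

/-- Gluing reverses orientation, so the side glued to `c` ends where `c` starts. -/
theorem vertex_next_opp (c : QuadCorner F) : L.vertex (next (L.opp c)) = L.vertex c := by
  rw [← vertex_rot, rot_next_opp]

theorem vertex_next_rot (c : QuadCorner F) : L.vertex (next (L.rot c)) = L.vertex (prev c) := by
  rw [rot_apply, vertex_next_opp]

@[simp] theorem edge_opp (c : QuadCorner F) : L.edge (L.opp c) = L.edge c :=
  Quotient.sound (Equiv.Perm.sameCycle_apply_left.2 (Equiv.Perm.SameCycle.refl _ _))

/-- Consecutive medial edges around a vertex share an end point; sums around a vertex telescope for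
this reason. -/
theorem edge_prev (c : QuadCorner F) : L.edge (prev c) = L.edge (L.rot c) := by
  rw [rot_apply, edge_opp]

theorem apply_eq_of_sameCycle {X Y : Type*} {σ : Equiv.Perm X} {f : X → Y}
    (h : ∀ x, f (σ x) = f x) {x y : X} (hxy : σ.SameCycle x y) : f x = f y := by
  obtain ⟨n, rfl⟩ := hxy
  have hi : ∀ x, f (σ⁻¹ x) = f x := fun x => by
    rw [← h (σ⁻¹ x)]; exact congrArg f (σ.apply_symm_apply x)
  induction n using Int.induction_on with
  | zero => simp
  | succ n ih => rw [add_comm, zpow_add, zpow_one, Equiv.Perm.mul_apply, h, ← ih]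
  | pred n ih => rw [sub_eq_add_neg, add_comm, zpow_add, zpow_neg_one, Equiv.Perm.mul_apply, hi,
      ← ih]

/-- A function on corners that is invariant under the rotations is a function on vertices. -/
theorem exists_vertex_lift {Y : Type*} (f : QuadCorner F → Y) (h : ∀ c, f (L.rot c) = f c) :
    ∃ f' : L.Vertex → Y, ∀ c, f' (L.vertex c) = f c :=
  ⟨Quotient.lift f fun _ _ hxy => apply_eq_of_sameCycle h hxy, fun _ => rfl⟩

/-- A function on sides that is invariant under the gluing is a function on edges. -/
theorem exists_edge_lift {Y : Type*} (f : QuadCorner F → Y) (h : ∀ c, f (L.opp c) = f c) :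
    ∃ f' : L.Edge → Y, ∀ c, f' (L.edge c) = f c :=
  ⟨Quotient.lift f fun _ _ hxy => apply_eq_of_sameCycle h hxy, fun _ => rfl⟩

instance [Finite F] : Finite L.Vertex := Quotient.finite _

/-- A rotational difference is orthogonal to the functions on vertices. -/
theorem sum_vertex_mul_sub_rot [Fintype F] (f : L.Vertex → ℂ) (k : QuadCorner F → ℂ) :
    ∑ c, f (L.vertex c) * (k c - k (L.rot c)) = 0 := by
  simp only [mul_sub, Finset.sum_sub_distrib, sub_eq_zero]
  rw [← Equiv.sum_comp L.rot fun c => f (L.vertex c) * k c]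
  simp

/-- `K` consists of all corners at the vertices of one of the two colours. -/
structure IsColorClass (K : Set (QuadCorner F)) : Prop where
  opp_mem : ∀ c, L.opp c ∈ K ↔ c ∉ K
  next_mem : ∀ c, next c ∈ K ↔ c ∉ K

theorem isColorClass_black : L.IsColorClass {c | c.IsBlack} where
  opp_mem := L.opp_isBlack
  next_mem := by
    rintro ⟨Q, i⟩
    fin_cases i <;> simp [IsBlack, next]

variable {L}

namespace IsColorClass

variable {K : Set (QuadCorner F)}

theorem prev_mem (hK : L.IsColorClass K) (c : QuadCorner F) : prev c ∈ K ↔ c ∉ K := by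
  have := hK.next_mem (prev c)
  rw [next_prev] at this
  tauto

/-- Both `prev` and `opp` swap the colours. Thus membership in `K` depends only on the vertex, and
it lifts to a function on vertices. -/
theorem rot_mem (hK : L.IsColorClass K) (c : QuadCorner F) : L.rot c ∈ K ↔ c ∈ K := by
  rw [rot_apply, hK.opp_mem, hK.prev_mem, not_not]

protected theorem compl (hK : L.IsColorClass K) : L.IsColorClass Kᶜ where
  opp_mem c := not_congr (hK.opp_mem c)
  next_mem c := not_congr (hK.next_mem c)

theorem add_two_mem (hK : L.IsColorClass K) (Q : F) (i : Fin 4) :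
    ((Q, i + 2) : QuadCorner F) ∈ K ↔ ((Q, i) : QuadCorner F) ∈ K := by
  have h : ((Q, i + 2) : QuadCorner F) = next (next (Q, i)) :=
    Prod.ext rfl (by simp only [next]; rw [add_assoc]; rfl)
  rw [h, hK.next_mem, hK.next_mem, not_not]

end IsColorClass

end QuadGluing

namespace DiscreteRiemannSurface

variable {F : Type*} (S : DiscreteRiemannSurface F)

open QuadCorner

/-! ### Cochains of type `◇`

A one-form is determined by the cochain of its values on the edges `(c, true)`. -/

/-- The gradient of a function on the vertices. -/
noncomputable def grad : (S.Vertex → ℂ) →ₗ[ℂ] (QuadCorner F → ℂ) where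
  toFun f c := (f (S.vertex c.next) - f (S.vertex (prev c))) / 2
  map_add' f g := by ext c; simp only [Pi.add_apply]; ring
  map_smul' r f := by ext c; simp only [Pi.smul_apply, smul_eq_mul, RingHom.id_apply]; ring

theorem grad_apply (f : S.Vertex → ℂ) (c : QuadCorner F) :
    S.grad f c = (f (S.vertex c.next) - f (S.vertex (prev c))) / 2 := rfl

/-- Cochains that take opposite values on opposite edges of each face. -/
def diamond (_S : DiscreteRiemannSurface F) : Submodule ℂ (QuadCorner F → ℂ) where
  carrier := {a | ∀ Q i, a (Q, i + 2) = -a (Q, i)}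
  add_mem' ha hb Q i := by simp only [Pi.add_apply, ha Q i, hb Q i]; ring
  zero_mem' Q i := by simp
  smul_mem' r a ha Q i := by simp only [Pi.smul_apply, ha Q i, smul_neg]

/-- Cochains whose sum around every vertex vanishes. -/
def vertexClosed [Fintype F] : Submodule ℂ (QuadCorner F → ℂ) where
  carrier := {a | ∀ f : S.Vertex → ℂ, ∑ c, f (S.vertex c) * a c = 0}
  add_mem' ha hb f := by
    simp only [Pi.add_apply, mul_add, Finset.sum_add_distrib]
    rw [ha f, hb f, add_zero]
  zero_mem' f := by simp
  smul_mem' r a ha f := by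
    simp only [Pi.smul_apply, smul_eq_mul, mul_left_comm _ r, ← Finset.mul_sum]
    rw [ha f, mul_zero]

variable {S} in
theorem mem_vertexClosed [Fintype F] {a : QuadCorner F → ℂ} :
    a ∈ S.vertexClosed ↔ ∀ f : S.Vertex → ℂ, ∑ c, f (S.vertex c) * a c = 0 := Iff.rfl

theorem sub_prev_mem_vertexClosed [Fintype F] (h : S.Edge → ℂ) :
    (fun c => h (S.edge c) - h (S.edge (prev c))) ∈ S.vertexClosed := fun f => by
  simp only [S.edge_prev]
  exact S.sum_vertex_mul_sub_rot f fun c => h (S.edge c)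

/-- Opposite corners see the same diagonal with its ends exchanged. -/
theorem grad_mem_diamond (f : S.Vertex → ℂ) : S.grad f ∈ S.diamond := by
  intro Q i
  have h1 : next ((Q, i + 2) : QuadCorner F) = prev (Q, i) :=
    Prod.ext rfl (by simp only [next, prev]; fin_cases i <;> rfl)
  have h2 : prev ((Q, i + 2) : QuadCorner F) = next (Q, i) :=
    Prod.ext rfl (by simp only [next, prev]; fin_cases i <;> rfl)
  rw [grad_apply, grad_apply, h1, h2]
  ring

theorem grad_mem_vertexClosed [Fintype F] (f : S.Vertex → ℂ) : S.grad f ∈ S.vertexClosed := by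
  intro u
  have := S.sum_vertex_mul_sub_rot u fun c => f (S.vertex c.next) / 2
  simpa only [grad_apply, S.vertex_next_rot, ← sub_div] using this

/-- Stokes for 1-chains: the coboundary is dual to `boundary₁`. -/
theorem linearCombination_sub_prev (h : S.Edge → ℂ) (γ : S.Chain) :
    Finsupp.linearCombination ℤ (fun c => h (S.edge c) - h (S.edge (prev c))) γ =
      Finsupp.linearCombination ℤ h (S.boundary₁ γ) := by
  induction γ using Finsupp.induction_linear with
  | zero => simp
  | add f g hf hg => rw [map_add, map_add, map_add, hf, hg]
  | single c n =>
    simp [boundary₁, source, target, smul_sub]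

/-! ### Exactness of the part of one colour -/

/-- The part of an exact cochain that is parallel to the diagonals of one colour vanishes on
cycles. -/
theorem linearCombination_indicator_grad {K : Set (QuadCorner F)} (hK : S.IsColorClass K)
    (f : S.Vertex → ℂ) {γ : S.Chain} (hγ : γ ∈ LinearMap.ker S.boundary₁) :
    Finsupp.linearCombination ℤ (Kᶜ.indicator (S.grad f)) γ = 0 := by
  classical
  -- Each edge has exactly one end in `K`; half the value of `f` there is a primitive on midpoints.
  -- Around a corner in `K` it is constant, around any other corner it changes by half the
  -- difference along the diagonal.
  obtain ⟨h, hh⟩ := S.exists_edge_lift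
    (fun c => if c ∈ K then f (S.vertex c) / 2 else f (S.vertex c.next) / 2) (by
      intro c
      by_cases hc : c ∈ K
      · simp [hK.opp_mem, hc, S.vertex_next_opp]
      · have := S.vertex_next_opp (S.opp c)
        rw [S.opp_opp] at this
        simp [hK.opp_mem, hc, this])
  have : Kᶜ.indicator (S.grad f) = fun c => h (S.edge c) - h (S.edge (prev c)) := by
    ext c
    rw [hh, hh]
    by_cases hc : c ∈ K
    · simp [hc, hK.prev_mem]
    · simp [hc, hK.prev_mem, grad_apply, sub_div]
  rw [this, linearCombination_sub_prev, LinearMap.mem_ker.1 hγ, map_zero]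

/-- If the part of a cochain that is parallel to the diagonals of one colour vanishes on cycles,
then this part is exact. -/
theorem exists_grad_eq_indicator {K : Set (QuadCorner F)} (hK : S.IsColorClass K)
    (a : QuadCorner F → ℂ)
    (ha : ∀ γ ∈ LinearMap.ker S.boundary₁,
      Finsupp.linearCombination ℤ (Kᶜ.indicator a) γ = 0) :
    ∃ f, S.grad f = Kᶜ.indicator a := by
  classical
  obtain ⟨ψ, hψ⟩ := exists_intLinear_factor S.boundary₁ _ ha
  have hψc (c : QuadCorner F) : ψ (Finsupp.single (S.edge c) 1) -
      ψ (Finsupp.single (S.edge (prev c)) 1) = Kᶜ.indicator a c := by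
    have := hψ (Finsupp.single c 1)
    simpa [boundary₁, source, target] using this
  -- The primitive `ψ` is constant on the midpoints around a vertex in `K`. The factor 2 cancels the
  -- half in `grad`; the value 0 at the other colour kills the gradient on `K`.
  obtain ⟨f, hf⟩ := S.exists_vertex_lift
    (fun c => if c ∈ K then 2 * ψ (Finsupp.single (S.edge c) 1) else 0) (by
      intro c
      by_cases hc : c ∈ K
      · have := hψc c
        rw [Set.indicator_of_notMem (by simpa using hc), sub_eq_zero, S.edge_prev] at this
        simp [hK.rot_mem, hc, this]
      · simp [hK.rot_mem, hc])
  refine ⟨f, funext fun c => ?_⟩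
  rw [grad_apply, hf, hf]
  by_cases hc : c ∈ K
  · simp [hK.prev_mem, hK.next_mem, hc]
  · rw [← hψc]
    -- The sides `c` and `c.next` meet at the vertex of `c.next`, which lies in `K`, so `ψ` agrees
    -- on them.
    have := hψc c.next
    rw [Set.indicator_of_notMem (by simpa [hK.next_mem] using hc), prev_next, sub_eq_zero] at this
    simp [hK.prev_mem, hK.next_mem, hc, this]
    ring

/-! ### Closed cochains and boundaries -/

theorem linearCombination_faceBoundary_inl [Fintype F] [DecidableEq S.Vertex]
    (a : QuadCorner F → ℂ) (v : S.Vertex) :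
    Finsupp.linearCombination ℤ a (S.faceBoundary (Sum.inl v)) =
      -∑ c with S.vertex c = v, a c := by
  simp only [faceBoundary, Sum.elim_inl, map_sum, edgeChain, map_neg,
    Finsupp.linearCombination_single, one_smul, Finset.sum_neg_distrib]
  congr!

theorem linearCombination_faceBoundary_inr [Fintype F] (a : QuadCorner F → ℂ) (Q : F) :
    Finsupp.linearCombination ℤ a (S.faceBoundary (Sum.inr Q)) = ∑ i, a (Q, i) := by
  simp [faceBoundary, edgeChain]

theorem mem_vertexClosed_iff [Fintype F] (a : QuadCorner F → ℂ) : a ∈ S.vertexClosed ↔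
    ∀ v, Finsupp.linearCombination ℤ a (S.faceBoundary (Sum.inl v)) = 0 := by
  classical
  have := Fintype.ofFinite S.Vertex
  simp only [linearCombination_faceBoundary_inl, neg_eq_zero]
  constructor
  · intro h v
    have := h (Pi.single v 1)
    simpa [Pi.single_apply, Finset.sum_filter] using this
  · intro h f
    rw [← Finset.sum_fiberwise Finset.univ S.vertex]
    refine Finset.sum_eq_zero fun v _ => ?_
    rw [← mul_zero (f v), ← h v, Finset.mul_sum]
    exact Finset.sum_congr rfl fun c hc => by rw [(Finset.mem_filter.1 hc).2]

/-- Opposite edges of `F_Q` cancel, so for type ◇ only the conditions at the vertices remain. -/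
theorem linearCombination_faceBoundary_inr_of_mem_diamond [Fintype F] {a : QuadCorner F → ℂ}
    (ha : a ∈ S.diamond) (Q : F) :
    Finsupp.linearCombination ℤ a (S.faceBoundary (Sum.inr Q)) = 0 := by
  have h0 : a (Q, 2) = -a (Q, 0) := ha Q 0
  have h1 : a (Q, 3) = -a (Q, 1) := ha Q 1
  rw [linearCombination_faceBoundary_inr, Fin.sum_univ_four, h0, h1]
  ring

theorem indicator_mem_diamond {K : Set (QuadCorner F)} (hK : S.IsColorClass K)
    {a : QuadCorner F → ℂ} (ha : a ∈ S.diamond) : K.indicator a ∈ S.diamond := by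
  intro Q i
  by_cases h : (Q, i) ∈ K
  · rw [Set.indicator_of_mem h, Set.indicator_of_mem ((hK.add_two_mem Q i).2 h), ha]
  · rw [Set.indicator_of_notMem h, Set.indicator_of_notMem (mt (hK.add_two_mem Q i).1 h), neg_zero]

/-- The boundary of `F_v` has a single colour, so restricting to one colour keeps or drops each
condition as a whole: the indicator is absorbed into the test function. -/
theorem indicator_mem_vertexClosed [Fintype F] {K : Set (QuadCorner F)} (hK : S.IsColorClass K)
    {a : QuadCorner F → ℂ} (ha : a ∈ S.vertexClosed) : K.indicator a ∈ S.vertexClosed := by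
  classical
  intro f
  obtain ⟨u, hu⟩ := S.exists_vertex_lift (fun c => if c ∈ K then (1 : ℂ) else 0)
    (by simp [hK.rot_mem])
  rw [← ha fun v => f v * u v]
  refine Finset.sum_congr rfl fun c _ => ?_
  rw [hu, Set.indicator_apply]
  split_ifs <;> simp

/-- A closed cochain of type `◇` vanishes on boundaries. -/
theorem linearCombination_boundary₂_eq_zero [Fintype F] {a : QuadCorner F → ℂ}
    (h₁ : a ∈ S.diamond) (h₂ : a ∈ S.vertexClosed) {γ : S.Chain}
    (hγ : γ ∈ LinearMap.range S.boundary₂) : Finsupp.linearCombination ℤ a γ = 0 := by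
  obtain ⟨x, rfl⟩ := hγ
  induction x using Finsupp.induction_linear with
  | zero => simp
  | add f g hf hg => rw [map_add, map_add, hf, hg, add_zero]
  | single φ n =>
    rw [boundary₂, Finsupp.linearCombination_single, map_smul]
    rcases φ with v | Q
    · rw [(S.mem_vertexClosed_iff a).1 h₂ v, smul_zero]
    · rw [S.linearCombination_faceBoundary_inr_of_mem_diamond h₁, smul_zero]

theorem boundary₁_faceBoundary [Fintype F] (φ : S.MedialFace) :
    S.boundary₁ (S.faceBoundary φ) = 0 := by
  classical
  -- Tested against functions on midpoints, the claim says that coboundaries sum to zero around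
  -- every face.
  have key (h : S.Edge → ℂ) :
      Finsupp.linearCombination ℤ h (S.boundary₁ (S.faceBoundary φ)) = 0 := by
    rw [← linearCombination_sub_prev]
    rcases φ with v | Q
    · exact (S.mem_vertexClosed_iff _).1 (S.sub_prev_mem_vertexClosed h) v
    · rw [linearCombination_faceBoundary_inr, Finset.sum_sub_distrib, sub_eq_zero]
      exact (Equiv.sum_comp (Equiv.subRight (1 : Fin 4)) fun i => h (S.edge (Q, i))).symm
  ext e
  have := key (Pi.single e 1)
  rw [Finsupp.linearCombination_apply, Finsupp.sum] at this
  simpa [Pi.single_apply] using this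

theorem range_boundary₂_le_ker [Fintype F] :
    LinearMap.range S.boundary₂ ≤ LinearMap.ker S.boundary₁ := by
  rintro _ ⟨x, rfl⟩
  rw [LinearMap.mem_ker]
  induction x using Finsupp.induction_linear with
  | zero => simp
  | add f g hf hg => rw [map_add, map_add, hf, hg, add_zero]
  | single φ n =>
    rw [boundary₂, Finsupp.linearCombination_single, map_smul, S.boundary₁_faceBoundary, smul_zero]

/-- Every cohomology class is represented by a closed cochain of type `◇` that vanishes on the edges
at the vertices of one colour. -/
theorem exists_closed_diamond [Fintype F] {K : Set (QuadCorner F)} (hK : S.IsColorClass K)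
    (η : S.Chain →ₗ[ℤ] ℂ) (hη : ∀ γ ∈ LinearMap.range S.boundary₂, η γ = 0) :
    ∃ a : QuadCorner F → ℂ, a ∈ S.diamond ∧ a ∈ S.vertexClosed ∧ (∀ c ∈ K, a c = 0) ∧
      ∀ γ ∈ LinearMap.ker S.boundary₁, Finsupp.linearCombination ℤ a γ = η γ := by
  classical
  let e (c : QuadCorner F) : ℂ := η (Finsupp.single c 1)
  have he (γ : S.Chain) : η γ = Finsupp.linearCombination ℤ e γ := by
    refine LinearMap.congr_fun (Finsupp.lhom_ext' fun c => LinearMap.ext_ring ?_) γ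
    simp [e]
  have hb (φ : S.MedialFace) : Finsupp.linearCombination ℤ e (S.faceBoundary φ) = 0 := by
    rw [← he]
    exact hη _ ⟨Finsupp.single φ 1, by simp [boundary₂]⟩
  have hv : e ∈ S.vertexClosed := (S.mem_vertexClosed_iff e).2 fun v => hb (Sum.inl v)
  -- Closedness at the vertices is the solvability condition for writing `e` on `K` as a difference
  -- along the rotations.
  obtain ⟨k, hk⟩ := S.rot.exists_sub_comp_eq (K.indicator e) (by
    intro f hf
    obtain ⟨f', hf'⟩ := S.exists_vertex_lift f hf
    simpa only [hf'] using S.indicator_mem_vertexClosed hK hv f')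
  -- Exactly one of the two sides on an edge is in `K`, so the values of `k` on `K` descend to
  -- midpoints. Subtracting the coboundary of `h` then clears `K`.
  obtain ⟨h, hh⟩ := S.exists_edge_lift (fun c => if c ∈ K then k c else k (S.opp c)) (by
    intro c
    by_cases hc : c ∈ K <;> simp [hK.opp_mem, hc, S.opp_opp])
  let a (c : QuadCorner F) : ℂ := e c - (h (S.edge c) - h (S.edge (prev c)))
  have haK : ∀ c ∈ K, a c = 0 := by
    intro c hc
    have := hk c
    simp only [Set.indicator_of_mem hc] at this
    simp only [a, hh, hK.prev_mem, hc, not_true_eq_false, if_true, if_false]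
    rw [← S.rot_apply, ← this, sub_self]
  have haγ (γ : S.Chain) : Finsupp.linearCombination ℤ a γ =
      η γ - Finsupp.linearCombination ℤ h (S.boundary₁ γ) := by
    rw [he, ← linearCombination_sub_prev]
    simp only [Finsupp.linearCombination_apply, Finsupp.sum, ← Finset.sum_sub_distrib, smul_sub, a]
  refine ⟨a, ?_, S.vertexClosed.sub_mem hv (S.sub_prev_mem_vertexClosed h), haK, ?_⟩
  · intro Q i
    by_cases hi : ((Q, i) : QuadCorner F) ∈ K
    · rw [haK _ hi, haK _ ((hK.add_two_mem Q i).2 hi), neg_zero]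
    · have h1 : ((Q, i + 1) : QuadCorner F) ∈ K := (hK.next_mem (Q, i)).2 hi
      have h3 : ((Q, i + 3) : QuadCorner F) ∈ K := by
        have := (hK.add_two_mem Q (i + 1)).2 h1
        rwa [add_assoc] at this
      -- Two of the four terms lie in `K` and vanish, so closedness on `F_Q` says that the other two
      -- are opposite.
      have hsum : ∑ j, a (Q, i + j) = 0 := by
        refine (Equiv.sum_comp (Equiv.addLeft i) fun j => a (Q, j)).trans ?_
        rw [← linearCombination_faceBoundary_inr, haγ, he, hb, S.boundary₁_faceBoundary, map_zero,
          sub_zero]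
      rw [Fin.sum_univ_four, haK _ h1, haK _ h3] at hsum
      simp only [add_zero] at hsum
      linear_combination hsum
  · intro γ hγ
    rw [haγ, LinearMap.mem_ker.1 hγ, map_zero, sub_zero]

/-! ### One-forms as cochains -/

namespace OneForm

variable {S}

/-- The values of a one-form on the edges `(c, true)`. -/
def cochain (ω : S.OneForm) (c : QuadCorner F) : ℂ := ω.toFun (c, true)

/-- The one-form with given values on the edges `(c, true)`. -/
def ofCochain (a : QuadCorner F → ℂ) : S.OneForm where
  toFun e := if e.2 then a e.1 else -a e.1
  reverse := by rintro ⟨c, _ | _⟩ <;> simp [DiscreteRiemannSurface.reverse]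

@[simp] theorem cochain_ofCochain (a : QuadCorner F → ℂ) :
    (ofCochain a : S.OneForm).cochain = a := by
  ext c; simp [cochain, ofCochain]

theorem cochain_injective : Function.Injective (cochain : S.OneForm → QuadCorner F → ℂ) := by
  intro ω ω' h
  ext ⟨c, s⟩
  cases s
  · have h1 := ω.reverse (c, true)
    have h2 := ω'.reverse (c, true)
    simp only [DiscreteRiemannSurface.reverse, Bool.not_true] at h1 h2
    rw [h1, h2]
    exact congrArg Neg.neg (congrFun h c)
  · exact congrFun h c

theorem integral_eq (ω : S.OneForm) (γ : S.Chain) :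
    ω.integral γ = Finsupp.linearCombination ℤ ω.cochain γ := by
  simp [integral, Finsupp.linearCombination_apply, cochain]

theorem integral_filter (ω : S.OneForm) (γ : S.Chain) (p : QuadCorner F → Prop)
    [DecidablePred p] : ω.integral (γ.filter p) =
      Finsupp.linearCombination ℤ ({c | p c}.indicator ω.cochain) γ := by
  rw [integral_eq]
  induction γ using Finsupp.induction_linear with
  | zero => rw [Finsupp.filter_zero, map_zero, map_zero]
  | add f g hf hg => rw [Finsupp.filter_add, map_add, map_add, hf, hg]
  | single c n =>
    by_cases hc : p c
    · simp [Finsupp.filter_single_of_pos, hc]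
    · simp [Finsupp.filter_single_of_neg, hc]

/-- On each face the star combines `dz` and its conjugate with constant coefficients, and both
change sign between opposite edges. -/
theorem cochain_hodgeStar_mem_diamond (ω : S.OneForm) : ω.hodgeStar.cochain ∈ S.diamond := by
  intro Q i
  have h : S.dz ((Q, i + 2), true) = -S.dz ((Q, i), true) := by
    have h1 : i + 2 + 1 = i - 1 := by fin_cases i <;> rfl
    have h2 : i + 2 - 1 = i + 1 := by fin_cases i <;> rfl
    simp only [dz, h1, h2]
    ring
  simp only [cochain, hodgeStar, h, map_neg]
  ring

theorem isHarmonic_iff [Fintype F] (ω : S.OneForm) : ω.IsHarmonic ↔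
    ω.cochain ∈ S.diamond ∧ ω.cochain ∈ S.vertexClosed ∧
      ω.hodgeStar.cochain ∈ S.vertexClosed := by
  have key (ω : S.OneForm) (h : ω.cochain ∈ S.diamond) :
      (∀ φ, ω.d φ = 0) ↔ ω.cochain ∈ S.vertexClosed := by
    simp only [mem_vertexClosed_iff, d, integral_eq, Sum.forall,
      S.linearCombination_faceBoundary_inr_of_mem_diamond h, implies_true, and_true]
  constructor
  · rintro ⟨h1, h2, h3⟩
    exact ⟨h1, (key _ h1).1 h2, (key _ ω.cochain_hodgeStar_mem_diamond).1 h3⟩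
  · rintro ⟨h1, h2, h3⟩
    exact ⟨h1, (key _ h1).2 h2, (key _ ω.cochain_hodgeStar_mem_diamond).2 h3⟩

end OneForm

/-! ### The Dirichlet form -/

/-- The determinant of the values of `dz_Q` and `dz̄_Q`. -/
noncomputable def det (Q : F) : ℂ :=
  S.dz ((Q, 1), true) * conj (S.dz ((Q, 2), true)) -
    S.dz ((Q, 2), true) * conj (S.dz ((Q, 1), true))

/-- The number `s` is half the shoelace area: the values of `dz` are half diagonals, and the area is
half the cross product of the diagonals. -/
theorem exists_det_eq (Q : F) : ∃ s : ℝ, 0 < s ∧ S.det Q = -(2 * Complex.I * s) := by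
  have h := (S.isQuadChart Q).area_pos
  refine ⟨(conj (S.dz ((Q, 1), true)) * S.dz ((Q, 2), true)).im, ?_, ?_⟩
  · simp [dz, Fin.sum_univ_four, show conj (2 : ℂ) = 2 from map_ofNat _ 2] at h ⊢
    linarith
  · apply Complex.ext <;> simp [det] <;> ring

/-- The pairing `∬ ω ∧ ⋆ω'` of cochains of type `◇`. -/
noncomputable def dirichlet [Fintype F] : LinearMap.BilinForm ℂ (QuadCorner F → ℂ) :=
  LinearMap.mk₂ ℂ
    (fun a b => ∑ Q, Complex.I / S.det Q *
      ((S.dz ((Q, 1), true) * conj (S.dz ((Q, 2), true)) +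
          conj (S.dz ((Q, 1), true)) * S.dz ((Q, 2), true)) *
        (a (Q, 1) * b (Q, 2) + a (Q, 2) * b (Q, 1)) -
      2 * (S.dz ((Q, 2), true) * conj (S.dz ((Q, 2), true))) * (a (Q, 1) * b (Q, 1)) -
      2 * (S.dz ((Q, 1), true) * conj (S.dz ((Q, 1), true))) * (a (Q, 2) * b (Q, 2))))
    (fun a a' b => by
      rw [← Finset.sum_add_distrib]
      exact Finset.sum_congr rfl fun Q _ => by simp only [Pi.add_apply]; ring)
    (fun r a b => by
      rw [smul_eq_mul, Finset.mul_sum]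
      exact Finset.sum_congr rfl fun Q _ => by simp only [Pi.smul_apply, smul_eq_mul]; ring)
    (fun a b b' => by
      rw [← Finset.sum_add_distrib]
      exact Finset.sum_congr rfl fun Q _ => by simp only [Pi.add_apply]; ring)
    (fun r a b => by
      rw [smul_eq_mul, Finset.mul_sum]
      exact Finset.sum_congr rfl fun Q _ => by simp only [Pi.smul_apply, smul_eq_mul]; ring)

theorem dirichlet_apply [Fintype F] (a b : QuadCorner F → ℂ) :
    S.dirichlet a b = ∑ Q, Complex.I / S.det Q *
      ((S.dz ((Q, 1), true) * conj (S.dz ((Q, 2), true)) +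
          conj (S.dz ((Q, 1), true)) * S.dz ((Q, 2), true)) *
        (a (Q, 1) * b (Q, 2) + a (Q, 2) * b (Q, 1)) -
      2 * (S.dz ((Q, 2), true) * conj (S.dz ((Q, 2), true))) * (a (Q, 1) * b (Q, 1)) -
      2 * (S.dz ((Q, 1), true) * conj (S.dz ((Q, 1), true))) * (a (Q, 2) * b (Q, 2))) := rfl

theorem dirichlet_comm [Fintype F] (a b : QuadCorner F → ℂ) :
    S.dirichlet a b = S.dirichlet b a := by
  rw [dirichlet_apply, dirichlet_apply]
  exact Finset.sum_congr rfl fun Q _ => by ring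

/-- Expanding the coefficients in the star over the denominator `S.det Q` gives the explicit
formula. That formula shows the symmetry; this one connects to co-closedness. -/
theorem dirichlet_eq_sum_hodgeStar [Fintype F] (a : QuadCorner F → ℂ) (ω : S.OneForm) :
    S.dirichlet a ω.cochain = ∑ Q, (a (Q, 1) * ω.hodgeStar.cochain (Q, 2) -
      a (Q, 2) * ω.hodgeStar.cochain (Q, 1)) := by
  rw [dirichlet_apply]
  refine Finset.sum_congr rfl fun Q _ => ?_
  simp only [OneForm.cochain, OneForm.hodgeStar, OneForm.coeffDz, OneForm.coeffDzBar]
  rw [show S.dz ((Q, 1), true) * conj (S.dz ((Q, 2), true)) -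
    S.dz ((Q, 2), true) * conj (S.dz ((Q, 1), true)) = S.det Q from rfl]
  simp only [div_eq_mul_inv]
  ring

/-- Discrete Stokes' theorem for the product of a function and a cochain of type `◇`. -/
theorem sum_grad_wedge [Fintype F] (f : S.Vertex → ℂ) {b : QuadCorner F → ℂ}
    (hb : b ∈ S.diamond) : ∑ Q, (S.grad f (Q, 1) * b (Q, 2) - S.grad f (Q, 2) * b (Q, 1)) =
      (∑ c, f (S.vertex c) * b c) / 2 := by
  rw [Fintype.sum_prod_type, Finset.sum_div]
  -- The identity holds on each face separately.
  refine Finset.sum_congr rfl fun Q _ => ?_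
  have h0 : b (Q, 2) = -b (Q, 0) := hb Q 0
  have h1 : b (Q, 3) = -b (Q, 1) := hb Q 1
  have g1 : S.grad f (Q, 1) = (f (S.vertex (Q, 2)) - f (S.vertex (Q, 0))) / 2 := rfl
  have g2 : S.grad f (Q, 2) = (f (S.vertex (Q, 3)) - f (S.vertex (Q, 1))) / 2 := rfl
  rw [Fin.sum_univ_four, g1, g2, h0, h1]
  ring

/-- The Euler–Lagrange equation of the Dirichlet energy: by Stokes, pairing with `grad f` is half
the pairing of `f` with the vertex sums of the star. -/
theorem dirichlet_grad_eq_zero_iff [Fintype F] (ω : S.OneForm) :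
    (∀ f, S.dirichlet (S.grad f) ω.cochain = 0) ↔ ω.hodgeStar.cochain ∈ S.vertexClosed := by
  simp only [dirichlet_eq_sum_hodgeStar, S.sum_grad_wedge _ ω.cochain_hodgeStar_mem_diamond,
    div_eq_zero_iff, OfNat.ofNat_ne_zero, or_false, mem_vertexClosed]

/-- The Dirichlet form is definite on cochains of type `◇`. -/
theorem eq_zero_of_dirichlet_conj [Fintype F] {a : QuadCorner F → ℂ} (ha : a ∈ S.diamond)
    (h : S.dirichlet (fun c => conj (a c)) a = 0) : a = 0 := by
  choose s hs hdet using S.exists_det_eq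
  -- Writing `a = p dz + q dz̄` on `Q`, the two squares are the squared moduli of `q * det Q` and `p
  -- * det Q`.
  have hterm : S.dirichlet (fun c => conj (a c)) a = ((∑ Q, (s Q)⁻¹ *
      (Complex.normSq (S.dz ((Q, 2), true) * a (Q, 1) - S.dz ((Q, 1), true) * a (Q, 2)) +
       Complex.normSq (conj (S.dz ((Q, 2), true)) * a (Q, 1) -
        conj (S.dz ((Q, 1), true)) * a (Q, 2))) / 2 : ℝ) : ℂ) := by
    rw [dirichlet_apply, Complex.ofReal_sum]
    refine Finset.sum_congr rfl fun Q _ => ?_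
    have hs' : (s Q : ℂ) ≠ 0 := Complex.ofReal_ne_zero.2 (hs Q).ne'
    have hI : Complex.I / S.det Q = -((s Q : ℂ)⁻¹ / 2) := by
      rw [hdet]
      field_simp [Complex.I_ne_zero]
    rw [hI]
    push_cast
    simp only [← Complex.mul_conj, map_sub, map_mul, Complex.conj_conj]
    ring
  rw [hterm, Complex.ofReal_eq_zero, Finset.sum_eq_zero_iff_of_nonneg] at h
  swap
  · intro Q _
    have := hs Q
    have h1 := Complex.normSq_nonneg
      (S.dz ((Q, 2), true) * a (Q, 1) - S.dz ((Q, 1), true) * a (Q, 2))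
    have h2 := Complex.normSq_nonneg (conj (S.dz ((Q, 2), true)) * a (Q, 1) -
        conj (S.dz ((Q, 1), true)) * a (Q, 2))
    positivity
  have hzero (Q : F) : a (Q, 1) = 0 ∧ a (Q, 2) = 0 := by
    have hQ := h Q (Finset.mem_univ Q)
    have h1 := Complex.normSq_nonneg
      (S.dz ((Q, 2), true) * a (Q, 1) - S.dz ((Q, 1), true) * a (Q, 2))
    have h2 := Complex.normSq_nonneg (conj (S.dz ((Q, 2), true)) * a (Q, 1) -
        conj (S.dz ((Q, 1), true)) * a (Q, 2))
    have hsum := (mul_eq_zero.1 ((div_eq_zero_iff.1 hQ).resolve_right two_ne_zero)).resolve_left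
      (inv_ne_zero (hs Q).ne')
    have e1 := Complex.normSq_eq_zero.1 (le_antisymm (by linarith) h1)
    have e2 := Complex.normSq_eq_zero.1 (le_antisymm (by linarith) h2)
    have hd : S.det Q ≠ 0 := OneForm.dz_det_ne_zero S Q
    constructor
    · refine (mul_eq_zero.1 ?_).resolve_left hd
      rw [det]
      linear_combination S.dz ((Q, 1), true) * e2 - conj (S.dz ((Q, 1), true)) * e1
    · refine (mul_eq_zero.1 ?_).resolve_left hd
      rw [det]
      linear_combination S.dz ((Q, 2), true) * e2 - conj (S.dz ((Q, 2), true)) * e1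
  ext ⟨Q, i⟩
  have h0 : a (Q, 2) = -a (Q, 0) := ha Q 0
  have h3 : a (Q, 3) = -a (Q, 1) := ha Q 1
  obtain ⟨z1, z2⟩ := hzero Q
  rw [z2, zero_eq_neg] at h0
  rw [z1, neg_zero] at h3
  fin_cases i <;> assumption

/-- The conjugate of a gradient is the gradient of the conjugate function, so bilinear orthogonality
to gradients includes vanishing of the Hermitian energy. -/
theorem eq_zero_of_mem_range_grad [Fintype F] {a : QuadCorner F → ℂ}
    (ha : a ∈ LinearMap.range S.grad) (h : ∀ f, S.dirichlet (S.grad f) a = 0) : a = 0 := by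
  obtain ⟨f, rfl⟩ := ha
  refine S.eq_zero_of_dirichlet_conj (S.grad_mem_diamond f) ?_
  rw [← h fun v => conj (f v)]
  congr 2
  ext c
  simp [grad_apply, show conj (2 : ℂ) = 2 from map_ofNat _ 2]

/-- Every cochain differs by a gradient from one that is orthogonal to all gradients. -/
theorem exists_grad_orthogonal [Fintype F] (a : QuadCorner F → ℂ) :
    ∃ f, ∀ u, S.dirichlet (S.grad u) (a - S.grad f) = 0 := by
  have hsymm : S.dirichlet.IsSymm := ⟨fun a b => S.dirichlet_comm a b⟩
  -- A complex symmetric form may have isotropic vectors; nondegeneracy holds here because the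
  -- gradients are stable under conjugation.
  have hnd : (S.dirichlet.restrict (LinearMap.range S.grad)).Nondegenerate := by
    have h : ∀ x : LinearMap.range S.grad,
        (∀ y : LinearMap.range S.grad, S.dirichlet y x = 0) → x = 0 := fun x hx =>
      Subtype.ext (S.eq_zero_of_mem_range_grad x.2 fun f => hx ⟨_, f, rfl⟩)
    exact ⟨fun x hx => h x fun y => (S.dirichlet_comm _ _).trans (hx y), fun x hx => h x hx⟩
  have hc := LinearMap.BilinForm.isCompl_orthogonal_of_restrict_nondegenerate hsymm.isRefl hnd
  obtain ⟨_, ⟨f, rfl⟩, r, hr, hfr⟩ := Submodule.mem_sup.1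
    (hc.sup_eq_top ▸ Submodule.mem_top : a ∈ _)
  refine ⟨f, fun u => ?_⟩
  rw [← hfr, add_sub_cancel_left]
  exact hr _ ⟨u, rfl⟩

/-! ### Functionals on the first homology group -/

section Homology

variable [Fintype F] {S} {g : ℕ} {α β : Fin g → S.ClosedPath}

/-- Homomorphisms that vanish on boundaries are determined on cycles by their values on a homology
basis. -/
theorem IsHomologyBasis.eq_zero (h : S.IsHomologyBasis α β) (η : S.Chain →ₗ[ℤ] ℂ)
    (hη : ∀ γ ∈ LinearMap.range S.boundary₂, η γ = 0)
    (hα : ∀ k, η (α k).chain = 0) (hβ : ∀ k, η (β k).chain = 0) :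
    ∀ γ ∈ LinearMap.ker S.boundary₁, η γ = 0 := by
  let φ : S.H₁ →ₗ[ℤ] ℂ := Submodule.liftQ _ (η.domRestrict _) fun x hx => hη _ hx
  have hφ : φ = 0 := by
    refine LinearMap.ext_on h.2 ?_
    rintro _ ⟨k | k, rfl⟩
    · exact hα k
    · exact hβ k
  intro γ hγ
  exact LinearMap.congr_fun hφ (Submodule.Quotient.mk ⟨γ, hγ⟩)

/-- The values on a homology basis can be prescribed. -/
theorem IsHomologyBasis.exists_eq (h : S.IsHomologyBasis α β) (A B : Fin g → ℂ) :
    ∃ η : S.Chain →ₗ[ℤ] ℂ, (∀ γ ∈ LinearMap.range S.boundary₂, η γ = 0) ∧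
      (∀ k, η (α k).chain = A k) ∧ ∀ k, η (β k).chain = B k := by
  let b := Module.Basis.mk h.1 h.2.ge
  let φ : S.H₁ →ₗ[ℤ] ℂ := b.constr ℤ (Sum.elim A B)
  -- Pulled back to cycles, `φ` extends to all chains because `ℂ` is divisible.
  obtain ⟨η, hη⟩ := exists_intLinear_extension (LinearMap.ker S.boundary₁)
    (φ ∘ₗ Submodule.mkQ _)
  have hb (i : Fin g ⊕ Fin g) : φ (Sum.elim (fun k => (α k).homologyClass)
      (fun k => (β k).homologyClass) i) = Sum.elim A B i := by
    have := b.constr_basis ℤ (Sum.elim A B) i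
    rwa [Module.Basis.mk_apply] at this
  refine ⟨η, fun γ hγ => ?_, fun k => ?_, fun k => ?_⟩
  · rw [hη ⟨γ, S.range_boundary₂_le_ker hγ⟩, LinearMap.comp_apply, Submodule.mkQ_apply,
      (Submodule.Quotient.mk_eq_zero _).2, map_zero]
    exact hγ
  · exact (hη ⟨_, (α k).chain_mem_ker⟩).trans (hb (Sum.inl k))
  · exact (hη ⟨_, (β k).chain_mem_ker⟩).trans (hb (Sum.inr k))

end Homology

/-! ### Periods -/

/-- Half the period of the part of a cochain that is parallel to the diagonals of the colour of
`K`. -/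
noncomputable def halfPeriod {S : DiscreteRiemannSurface F} (K : Set (QuadCorner F))
    (P : S.ClosedPath) : (QuadCorner F → ℂ) →+ ℂ where
  -- The complement appears because the diagonal parallel to the edge at `c` joins vertices of the
  -- colour opposite to that of `c`.
  toFun a := Finsupp.linearCombination ℤ (Kᶜ.indicator a) P.chain
  map_zero' := by simp
  map_add' a b := by
    simp only [Finsupp.linearCombination_apply, Finsupp.sum, Set.indicator_add', Pi.add_apply,
      smul_add, Finset.sum_add_distrib]

section Periods

variable {S}

theorem halfPeriod_apply (K : Set (QuadCorner F)) (P : S.ClosedPath) (a : QuadCorner F → ℂ) :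
    halfPeriod K P a = Finsupp.linearCombination ℤ (Kᶜ.indicator a) P.chain := rfl

theorem OneForm.blackPeriod_eq (ω : S.OneForm) (P : S.ClosedPath) :
    ω.blackPeriod P = 2 * halfPeriod {c | c.IsBlack} P ω.cochain := by
  rw [blackPeriod, integral_filter]
  rfl

theorem OneForm.whitePeriod_eq (ω : S.OneForm) (P : S.ClosedPath) :
    ω.whitePeriod P = 2 * halfPeriod {c | c.IsBlack}ᶜ P ω.cochain := by
  rw [whitePeriod, integral_filter, halfPeriod_apply, compl_compl]

theorem halfPeriod_grad {K : Set (QuadCorner F)} (hK : S.IsColorClass K) (P : S.ClosedPath)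
    (f : S.Vertex → ℂ) : halfPeriod K P (S.grad f) = 0 :=
  S.linearCombination_indicator_grad hK f P.chain_mem_ker

theorem halfPeriod_eq_zero {K : Set (QuadCorner F)} (P : S.ClosedPath) {a : QuadCorner F → ℂ}
    (ha : ∀ c ∈ Kᶜ, a c = 0) : halfPeriod K P a = 0 := by
  have : Kᶜ.indicator a = 0 := Set.indicator_eq_zero'.2 <|
    Set.disjoint_left.2 fun c hc hc' => hc (ha c hc')
  rw [halfPeriod_apply, this]
  simp

theorem halfPeriod_eq_linearCombination {K : Set (QuadCorner F)} (P : S.ClosedPath)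
    {a : QuadCorner F → ℂ} (ha : ∀ c ∈ K, a c = 0) :
    halfPeriod K P a = Finsupp.linearCombination ℤ a P.chain := by
  rw [halfPeriod_apply, Set.indicator_eq_self.2]
  exact fun c hc hcK => hc (ha c hcK)

variable [Fintype F] {g : ℕ} {α β : Fin g → S.ClosedPath}

/-- A closed cochain of type `◇` without periods is exact. -/
theorem IsHomologyBasis.mem_range_grad (h : S.IsHomologyBasis α β) {K : Set (QuadCorner F)}
    (hK : S.IsColorClass K) {a : QuadCorner F → ℂ} (h₁ : a ∈ S.diamond) (h₂ : a ∈ S.vertexClosed)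
    (hα : ∀ k, halfPeriod K (α k) a = 0) (hβ : ∀ k, halfPeriod K (β k) a = 0)
    (hα' : ∀ k, halfPeriod Kᶜ (α k) a = 0) (hβ' : ∀ k, halfPeriod Kᶜ (β k) a = 0) :
    a ∈ LinearMap.range S.grad := by
  -- The part of one colour is itself a cocycle, so its values on the homology basis decide whether
  -- it is exact.
  have key {K : Set (QuadCorner F)} (hK : S.IsColorClass K)
      (hα : ∀ k, halfPeriod K (α k) a = 0) (hβ : ∀ k, halfPeriod K (β k) a = 0) :
      ∃ f, S.grad f = Kᶜ.indicator a :=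
    S.exists_grad_eq_indicator hK a <| h.eq_zero _
      (fun _ hγ => S.linearCombination_boundary₂_eq_zero (S.indicator_mem_diamond hK.compl h₁)
        (S.indicator_mem_vertexClosed hK.compl h₂) hγ) hα hβ
  obtain ⟨f, hf⟩ := key hK hα hβ
  obtain ⟨f', hf'⟩ := key hK.compl hα' hβ'
  refine ⟨f + f', ?_⟩
  rw [map_add, hf, hf', Set.indicator_self_add_compl]

/-- There is a closed cochain of type `◇` with given periods. -/
theorem IsHomologyBasis.exists_periods (h : S.IsHomologyBasis α β) {K : Set (QuadCorner F)}
    (hK : S.IsColorClass K) (A B A' B' : Fin g → ℂ) :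
    ∃ a ∈ S.diamond, a ∈ S.vertexClosed ∧
      ∀ k, halfPeriod K (α k) a = A k ∧ halfPeriod K (β k) a = B k ∧
        halfPeriod Kᶜ (α k) a = A' k ∧ halfPeriod Kᶜ (β k) a = B' k := by
  obtain ⟨η, hη, hA, hB⟩ := h.exists_eq A B
  obtain ⟨η', hη', hA', hB'⟩ := h.exists_eq A' B'
  -- The two classes are realized on disjoint sets of edges, so neither summand disturbs the periods
  -- of the other.
  obtain ⟨a, h₁, h₂, h₃, ha⟩ := S.exists_closed_diamond hK η hη
  obtain ⟨a', h₁', h₂', h₃', ha'⟩ := S.exists_closed_diamond hK.compl η' hη'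
  have hp (P : S.ClosedPath) : halfPeriod K P (a + a') = η P.chain := by
    rw [map_add, halfPeriod_eq_linearCombination P h₃, halfPeriod_eq_zero P h₃', add_zero,
      ha _ P.chain_mem_ker]
  have hp' (P : S.ClosedPath) : halfPeriod Kᶜ P (a + a') = η' P.chain := by
    rw [map_add, halfPeriod_eq_linearCombination P h₃',
      halfPeriod_eq_zero P (by rwa [compl_compl]), zero_add, ha' _ P.chain_mem_ker]
  refine ⟨a + a', add_mem h₁ h₁', add_mem h₂ h₂', fun k => ?_⟩
  rw [hp, hp, hp', hp', hA, hB, hA', hB']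
  exact ⟨rfl, rfl, rfl, rfl⟩

end Periods

end DiscreteRiemannSurface

/-! ### Existence and uniqueness -/

theorem mainTheorem6 {F : Type*} [Fintype F] (S : DiscreteRiemannSurface F)
    {g : ℕ} (α β : Fin g → S.ClosedPath) (hαβ : S.IsHomologyBasis α β)
    (AB BB AW BW : Fin g → ℂ) :
    ∃! ω : S.OneForm, ω.IsHarmonic ∧
      ∀ k, ω.blackPeriod (α k) = AB k ∧ ω.blackPeriod (β k) = BB k ∧
        ω.whitePeriod (α k) = AW k ∧ ω.whitePeriod (β k) = BW k := by
  have hK := S.isColorClass_black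
  simp only [DiscreteRiemannSurface.OneForm.isHarmonic_iff,
    ← DiscreteRiemannSurface.dirichlet_grad_eq_zero_iff,
    DiscreteRiemannSurface.OneForm.blackPeriod_eq,
    DiscreteRiemannSurface.OneForm.whitePeriod_eq]
  obtain ⟨a, h₁, h₂, ha⟩ := hαβ.exists_periods hK (fun k => AB k / 2) (fun k => BB k / 2)
    (fun k => AW k / 2) (fun k => BW k / 2)
  obtain ⟨f, hf⟩ := S.exists_grad_orthogonal a
  refine ⟨DiscreteRiemannSurface.OneForm.ofCochain (a - S.grad f), ⟨⟨?_, ?_, ?_⟩, fun k => ?_⟩, ?_⟩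
  · rw [DiscreteRiemannSurface.OneForm.cochain_ofCochain]
    exact sub_mem h₁ (S.grad_mem_diamond f)
  · rw [DiscreteRiemannSurface.OneForm.cochain_ofCochain]
    exact sub_mem h₂ (S.grad_mem_vertexClosed f)
  · rwa [DiscreteRiemannSurface.OneForm.cochain_ofCochain]
  · obtain ⟨e1, e2, e3, e4⟩ := ha k
    simp only [DiscreteRiemannSurface.OneForm.cochain_ofCochain, map_sub,
      DiscreteRiemannSurface.halfPeriod_grad hK, DiscreteRiemannSurface.halfPeriod_grad hK.compl,
      e1, e2, e3, e4, sub_zero, mul_div_cancel₀ _ (two_ne_zero' ℂ), and_self]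
  · rintro ω ⟨⟨w1, w2, w3⟩, w4⟩
    apply DiscreteRiemannSurface.OneForm.cochain_injective
    rw [DiscreteRiemannSurface.OneForm.cochain_ofCochain, ← sub_eq_zero]
    have hd₁ := sub_mem w1 (sub_mem h₁ (S.grad_mem_diamond f))
    have hd₂ := sub_mem w2 (sub_mem h₂ (S.grad_mem_vertexClosed f))
    -- The difference is a gradient because its periods cancel, and it is orthogonal to gradients
    -- because both forms are.
    refine S.eq_zero_of_mem_range_grad (hαβ.mem_range_grad hK hd₁ hd₂ ?_ ?_ ?_ ?_) fun u => by
      rw [map_sub, w3, hf, sub_zero]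
    all_goals
      intro k
      obtain ⟨e1, e2, e3, e4⟩ := ha k
      obtain ⟨v1, v2, v3, v4⟩ := w4 k
      simp only [map_sub, DiscreteRiemannSurface.halfPeriod_grad hK,
        DiscreteRiemannSurface.halfPeriod_grad hK.compl, e1, e2, e3, e4, sub_zero,
        ← v1, ← v2, ← v3, ← v4, mul_div_cancel_left₀ _ (two_ne_zero' ℂ), sub_self]
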